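/- Let $d\ge 1$ be an integer, let $\mathbb B_d$ be the open Euclidean unit ball of $\mathbb C^d$, and for a positive integer $m$ let $$k_m(z,w)=\Big(\frac1{1-\langle z,w\rangle}\Big)^m=\sum_{j\ge 0}a_j^{(m)}\langle z,w\rangle^j\qquad(z,w\in\mathbb B_d).$$ Define $b_j^{(m)}$ by $\sum_{j\ge1}b^{(m)}_jt^j=1-1/\sum_{j\ge0}a^{(m)}_jt^j$, and put $a^{(m)}_\alpha=a^{(m)}_{|\alpha|}\frac{|\alpha|!}{\alpha!}$, $b^{(m)}_\alpha=b^{(m)}_{|\alpha|}\frac{|\alpha|!}{\alpha!}$ for multi-indices $\alpha\in\mathbb Z_+^d$. For a complex Hilbert space $\mathcal E$ let $H_{k_m}(\mathcal E)$ be the Hilbert space of functions $f(z)=\sum_\alpha z^\alpha c_\alpha$ on $\mathbb B_d$ with $c_\alpha\in\mathcal E$ and $\|f\|^2=\sum_\alpha\|c_\alpha\|^2/a^{(m)}_\alpha<\infty$. A commuting $d$-tuple $T$ of bounded operators on a complex Hilbert space $\mathcal H$ is a $1/k_m$-contraction if $\sum_{\alpha\ne0}b^{(m)}_\alpha T^\alpha(T^\alpha)^*$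 converges in the strong operator topology to a contraction; then $\Delta_T=\big(I-\sum_{\alpha\neq 0}b^{(m)}_\alpha T^\alpha(T^\alpha)^*\big)^{1/2}$, and $T$ is called pure if $\sum_\alpha a^{(m)}_\alpha T^\alpha\Delta_T^2(T^\alpha)^*=I$ strongly. For a pure $1/k_m$-contraction let $\mathcal D=\overline{\mathrm{Ran}}\,\Delta_T$ and let $V_T:\mathcal H\to H_{k_m}(\mathcal D)$ be the isometry $(V_Th)(z)=\sum_\alpha a^{(m)}_\alpha z^\alpha\Delta_T(T^\alpha)^*h$. Say that $k_m$ admits a characteristic function through $k_n$ if for every pure $1/k_m$-contraction $T$ there exist a Hilbert space $\mathcal E$ and an analytic function $\theta:\mathbb B_d\to\mathcal B(\mathcal E,\mathcal D)$ such that $M_\theta f=\theta f$ defines a bounded operator $M_\theta:H_{k_n}(\mathcal E)\to H_{k_m}(\mathcal D)$ and $I-V_TV_T^*=M_\theta M_\theta^*$. **Theorem.** Let $d,m,n$ be positive integers. If $k_m$ admits a characteristic function through $k_n$, then $n=1$. -/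

import Mathlib

open scoped InnerProductSpace

universe u v

noncomputable section

/-- The monomial `z ^ α = z₁ ^ α₁ ⋯ z_d ^ α_d`. -/
def multiPow {d : ℕ} (z : EuclideanSpace ℂ (Fin d)) (α : Fin d → ℕ) : ℂ :=
  ∏ i, z i ^ α i

/-- The coefficients of a power series in `d` variables are determined by its sum near `0`. -/
theorem eq_zero_of_hasSum_zero {E : Type*} [NormedAddCommGroup E] [NormedSpace ℂ E]
    [CompleteSpace E] {r : ℝ} (hr : 0 < r) :
    ∀ {d : ℕ} (c : (Fin d → ℕ) → E),
      (∀ z : Fin d → ℂ, (∀ i, ‖z i‖ < r) → HasSum (fun α => (∏ i, z i ^ α i) • c α) 0) →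
        ∀ α, c α = 0
  | 0, c, h, α => by
    have h0 := h 0 (fun i => i.elim0)
    have h1 := h0.unique (hasSum_unique _)
    rw [Finset.univ_eq_empty, Finset.prod_empty, one_smul] at h1
    exact (congrArg c (Subsingleton.elim _ _)).trans h1.symm
  | d + 1, c, h, α => by
    have key : ∀ n, ∀ β : Fin d → ℕ, c (Fin.cons n β) = 0 := by
      intro n
      refine eq_zero_of_hasSum_zero hr (fun β => c (Fin.cons n β)) fun w hw => ?_
      have hprod : ∀ t : ℂ, ‖t‖ < r → HasSum (fun p : ℕ × (Fin d → ℕ) =>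
          (t ^ p.1 * ∏ i, w i ^ p.2 i) • c (Fin.cons p.1 p.2)) 0 := by
        intro t ht
        have h1 := h (Fin.cons t w) (Fin.cases ht hw)
        rw [← (Fin.consEquiv fun _ : Fin (d + 1) => ℕ).hasSum_iff] at h1
        refine h1.congr_fun ?_
        intro p
        simp [Fin.consEquiv, Fin.prod_univ_succ]
      have hfib : ∀ n, Summable fun β : Fin d → ℕ => (∏ i, w i ^ β i) • c (Fin.cons n β) := by
        intro n
        have hr2 : ‖((r / 2 : ℝ) : ℂ)‖ < r := by
          rw [Complex.norm_real, Real.norm_of_nonneg (by positivity)]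
          linarith
        have h1 := (hprod _ hr2).summable.prod_factor n
        simp only [mul_smul] at h1
        have hne : ((r / 2 : ℝ) : ℂ) ^ n ≠ 0 :=
          pow_ne_zero _ (Complex.ofReal_ne_zero.2 (by positivity))
        refine (h1.const_smul (((r / 2 : ℝ) : ℂ) ^ n)⁻¹).congr fun β => ?_
        rw [inv_smul_smul₀ hne]
      have hone : ∀ t : ℂ, ‖t‖ < r → HasSum (fun n : ℕ =>
          t ^ n • ∑' β : Fin d → ℕ, (∏ i, w i ^ β i) • c (Fin.cons n β)) 0 := by
        intro t ht
        refine (hprod t ht).prod_fiberwise fun n => ?_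
        simp only [mul_smul]
        exact (hfib n).hasSum.const_smul _
      let p : FormalMultilinearSeries ℂ ℂ E := fun n =>
        ContinuousMultilinearMap.mkPiRing ℂ (Fin n)
          (∑' β : Fin d → ℕ, (∏ i, w i ^ β i) • c (Fin.cons n β))
      have hp : HasFPowerSeriesAt (fun _ => (0 : E)) p 0 := by
        rw [hasFPowerSeriesAt_iff]
        filter_upwards [Metric.ball_mem_nhds (0 : ℂ) hr] with t ht
        have := hone t (by simpa using ht)
        simpa [p, FormalMultilinearSeries.coeff] using this
      have hp0 : p = 0 := hp.eq_zero
      have hc : p.coeff n = 0 := by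
        rw [hp0]
        rfl
      have hz : ∑' β : Fin d → ℕ, (∏ i, w i ^ β i) • c (Fin.cons n β) = 0 := by
        simpa [p, FormalMultilinearSeries.coeff] using hc
      rw [← hz]
      exact (hfib n).hasSum
    rw [← Fin.cons_self_tail α]
    exact key _ _

/-- The operator monomial `T ^ α = T₁ ^ α₁ ⋯ T_d ^ α_d`. -/
def tuplePow {d : ℕ} {H : Type*} [NormedAddCommGroup H] [InnerProductSpace ℂ H]
    (T : Fin d → H →L[ℂ] H) (α : Fin d → ℕ) : H →L[ℂ] H :=
  (List.ofFn fun i => T i ^ α i).prod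

/-- A non-vanishing unitarily invariant kernel `k(z, w) = ∑ aₙ ⟨z, w⟩ⁿ` on the open unit ball of
`ℂ^d`, with `aₙ > 0` and `a₀ = 1`. The pairing `⟨z, w⟩ = ∑ zᵢ * conj wᵢ` is linear in `z`, hence it
is `⟪w, z⟫_ℂ` in Mathlib's convention. -/
structure UnitarilyInvariantKernel (d : ℕ) where
  coeff : ℕ → ℝ
  coeff_zero : coeff 0 = 1
  coeff_pos : ∀ n, 0 < coeff n
  summable : ∀ z ∈ Metric.ball (0 : EuclideanSpace ℂ (Fin d)) 1,
    ∀ w ∈ Metric.ball (0 : EuclideanSpace ℂ (Fin d)) 1,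
    Summable fun n => (coeff n : ℂ) * ⟪w, z⟫_ℂ ^ n
  nonvanishing : ∀ z ∈ Metric.ball (0 : EuclideanSpace ℂ (Fin d)) 1,
    ∀ w ∈ Metric.ball (0 : EuclideanSpace ℂ (Fin d)) 1,
    ∑' n, (coeff n : ℂ) * ⟪w, z⟫_ℂ ^ n ≠ 0

namespace UnitarilyInvariantKernel

variable {d : ℕ} (k l : UnitarilyInvariantKernel d)

/-- The kernel as a function `k(z, w)`. -/
def toFun (z w : EuclideanSpace ℂ (Fin d)) : ℂ :=
  ∑' n, (k.coeff n : ℂ) * ⟪w, z⟫_ℂ ^ n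

/-- The coefficients `bₙ` in `∑_{n ≥ 1} bₙ tⁿ = 1 - 1 / ∑_{n ≥ 0} aₙ tⁿ`. -/
def bCoeff (n : ℕ) : ℝ :=
  PowerSeries.coeff n (1 - (PowerSeries.mk k.coeff)⁻¹)

/-- `a_α = a_{|α|} * |α|! / α!`. -/
def aMulti (α : Fin d → ℕ) : ℝ :=
  k.coeff (∑ i, α i) * (Nat.multinomial Finset.univ α : ℝ)

/-- `b_α = b_{|α|} * |α|! / α!`. -/
def bMulti (α : Fin d → ℕ) : ℝ :=
  k.bCoeff (∑ i, α i) * (Nat.multinomial Finset.univ α : ℝ)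

theorem aMulti_pos (α : Fin d → ℕ) : 0 < k.aMulti α :=
  mul_pos (k.coeff_pos _) (by exact_mod_cast Nat.multinomial_pos _ _)

/-! ### The generalized Bergman kernels -/

theorem bergman_hasSum (m : ℕ+) {t : ℂ} (ht : ‖t‖ < 1) :
    HasSum (fun n : ℕ => (((n + ((m : ℕ) - 1)).choose ((m : ℕ) - 1) : ℝ) : ℂ) * t ^ n)
      ((1 / (1 - t)) ^ (m : ℕ)) := by
  have h := hasSum_choose_mul_geometric_of_norm_lt_one ((m : ℕ) - 1) ht
  have hm : (m : ℕ) - 1 + 1 = m := Nat.sub_add_cancel m.pos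
  rw [hm, ← one_div_pow] at h
  exact_mod_cast h

theorem norm_inner_lt_one {z w : EuclideanSpace ℂ (Fin d)}
    (hz : z ∈ Metric.ball (0 : EuclideanSpace ℂ (Fin d)) 1)
    (hw : w ∈ Metric.ball (0 : EuclideanSpace ℂ (Fin d)) 1) : ‖⟪w, z⟫_ℂ‖ < 1 := by
  rw [mem_ball_zero_iff] at hz hw
  have := norm_inner_le_norm (𝕜 := ℂ) w z
  nlinarith [norm_nonneg z, norm_nonneg w]

/-- The generalized Bergman kernel `k_m(z, w) = (1 / (1 - ⟨z, w⟩)) ^ m`, with power series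
coefficients `aₙ = (n + m - 1).choose (m - 1)`; see `bergman_apply`. -/
def bergman (d : ℕ) (m : ℕ+) : UnitarilyInvariantKernel d where
  coeff n := ((n + ((m : ℕ) - 1)).choose ((m : ℕ) - 1) : ℝ)
  coeff_zero := by simp
  coeff_pos n := by exact_mod_cast Nat.choose_pos (Nat.le_add_left _ _)
  summable _ hz _ hw := (bergman_hasSum m (norm_inner_lt_one hz hw)).summable
  nonvanishing z hz w hw := by
    have h := norm_inner_lt_one hz hw
    rw [(bergman_hasSum m h).tsum_eq]
    refine pow_ne_zero _ (one_div_ne_zero (sub_ne_zero.2 fun h1 => ?_))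
    rw [← h1] at h
    simp at h

theorem bergman_apply (m : ℕ+) {z w : EuclideanSpace ℂ (Fin d)}
    (hz : z ∈ Metric.ball (0 : EuclideanSpace ℂ (Fin d)) 1)
    (hw : w ∈ Metric.ball (0 : EuclideanSpace ℂ (Fin d)) 1) :
    (bergman d m).toFun z w = (1 / (1 - ⟪w, z⟫_ℂ)) ^ (m : ℕ) :=
  (bergman_hasSum m (norm_inner_lt_one hz hw)).tsum_eq

/-! ### The vector-valued space `H_k(E)` -/

/-- The Hilbert space `H_k(E) = H_k ⊗ E` of functions `f(z) = ∑ z ^ α • c_α` on the ball with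
`‖f‖² = ∑ ‖c_α‖² / a_α < ∞`. Here `f` is stored through its normalized coefficients
`f_α = c_α / √(a_α)`, so that `f(z) = ∑ √(a_α) * z ^ α • f_α`; the elements become functions on
the ball through the `RKHS` instance below (see `taylorCoeff`, `hasSum_apply`,
`norm_sq_eq_tsum`, `taylorCoeff_ofTaylor`, `kernel_HSpace`). -/
def HSpace (_k : UnitarilyInvariantKernel d) (E : Type*) [NormedAddCommGroup E]
    [InnerProductSpace ℂ E] : Type _ :=
  lp (fun _ : Fin d → ℕ => E) 2

section HSpace

variable (E : Type*) [NormedAddCommGroup E] [InnerProductSpace ℂ E]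

instance : NormedAddCommGroup (k.HSpace E) :=
  inferInstanceAs (NormedAddCommGroup (lp (fun _ : Fin d → ℕ => E) 2))

instance : InnerProductSpace ℂ (k.HSpace E) :=
  inferInstanceAs (InnerProductSpace ℂ (lp (fun _ : Fin d → ℕ => E) 2))

instance [CompleteSpace E] : CompleteSpace (k.HSpace E) :=
  inferInstanceAs (CompleteSpace (lp (fun _ : Fin d → ℕ => E) 2))

variable {E}

/-- The normalized coefficients `c_α / √(a_α)` of an element of `H_k(E)`. -/
def HSpace.seq (f : k.HSpace E) : lp (fun _ : Fin d → ℕ => E) 2 := f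

/-- The Taylor coefficient `c_α` of an element of `H_k(E)`. -/
def taylorCoeff (f : k.HSpace E) (α : Fin d → ℕ) : E :=
  ((√(k.aMulti α) : ℝ) : ℂ) • (HSpace.seq k f) α

theorem memLp_two_iff {F : Type*} [NormedAddCommGroup F] {u : (Fin d → ℕ) → F} :
    Memℓp u 2 ↔ Summable fun α => ‖u α‖ ^ 2 := by
  rw [memℓp_gen_iff (by norm_num)]
  norm_num

theorem summable_seq (f : k.HSpace E) : Summable fun α => ‖(HSpace.seq k f) α‖ ^ 2 :=
  memLp_two_iff.1 (lp.memℓp (HSpace.seq k f))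

theorem norm_sq_eq_tsum_seq (f : k.HSpace E) :
    ‖f‖ ^ 2 = ∑' α, ‖(HSpace.seq k f) α‖ ^ 2 := by
  have h := lp.norm_rpow_eq_tsum (p := 2) (by norm_num) (HSpace.seq k f)
  norm_num at h
  exact h

/-- `‖f‖² = ∑ ‖c_α‖² ‖z ^ α‖²`, where `‖z ^ α‖² = 1 / a_α`. -/
theorem norm_sq_eq_tsum (f : k.HSpace E) :
    ‖f‖ ^ 2 = ∑' α, ‖k.taylorCoeff f α‖ ^ 2 / k.aMulti α := by
  rw [norm_sq_eq_tsum_seq]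
  refine tsum_congr fun α => ?_
  have h := k.aMulti_pos α
  rw [taylorCoeff, norm_smul, mul_pow, Complex.norm_real, Real.norm_eq_abs, sq_abs,
    Real.sq_sqrt h.le, mul_div_cancel_left₀ _ h.ne']

/-- The element of `H_k(E)` with given Taylor coefficients. -/
def ofTaylor (c : (Fin d → ℕ) → E) (hc : Summable fun α => ‖c α‖ ^ 2 / k.aMulti α) :
    k.HSpace E :=
  (⟨fun α => (((√(k.aMulti α))⁻¹ : ℝ) : ℂ) • c α, memLp_two_iff.2 (by
    refine hc.congr fun α => ?_
    rw [norm_smul, mul_pow, Complex.norm_real, Real.norm_eq_abs, sq_abs, inv_pow,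
      Real.sq_sqrt (k.aMulti_pos α).le, div_eq_inv_mul])⟩ : lp (fun _ : Fin d → ℕ => E) 2)

@[simp]
theorem taylorCoeff_ofTaylor (c : (Fin d → ℕ) → E)
    (hc : Summable fun α => ‖c α‖ ^ 2 / k.aMulti α) (α : Fin d → ℕ) :
    k.taylorCoeff (k.ofTaylor c hc) α = c α := by
  have h : √(k.aMulti α) ≠ 0 := (Real.sqrt_pos.2 (k.aMulti_pos α)).ne'
  change ((√(k.aMulti α) : ℝ) : ℂ) • (((√(k.aMulti α))⁻¹ : ℝ) : ℂ) • c α = c α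
  rw [smul_smul, ← Complex.ofReal_mul, mul_inv_cancel₀ h, Complex.ofReal_one, one_smul]

theorem taylorCoeff_add (f g : k.HSpace E) (α : Fin d → ℕ) :
    k.taylorCoeff (f + g) α = k.taylorCoeff f α + k.taylorCoeff g α :=
  smul_add _ _ _

theorem taylorCoeff_smul (c : ℂ) (f : k.HSpace E) (α : Fin d → ℕ) :
    k.taylorCoeff (c • f) α = c • k.taylorCoeff f α :=
  smul_comm _ _ _

theorem ext_taylorCoeff {f g : k.HSpace E} (h : ∀ α, k.taylorCoeff f α = k.taylorCoeff g α) :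
    f = g := by
  refine lp.ext (funext fun α => ?_)
  have h0 : ((√(k.aMulti α) : ℝ) : ℂ) ≠ 0 :=
    Complex.ofReal_ne_zero.2 (Real.sqrt_pos.2 (k.aMulti_pos α)).ne'
  exact smul_right_injective E h0 (h α)

theorem sum_piAntidiag (z w : EuclideanSpace ℂ (Fin d)) (n : ℕ) :
    ∑ α ∈ Finset.piAntidiag Finset.univ n,
      (k.aMulti α : ℂ) * (multiPow z α * starRingEnd ℂ (multiPow w α)) =
      (k.coeff n : ℂ) * ⟪w, z⟫_ℂ ^ n := by
  have h : ⟪w, z⟫_ℂ = ∑ i, z i * starRingEnd ℂ (w i) := by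
    simp [PiLp.inner_apply]
  rw [h, Finset.sum_pow_eq_sum_piAntidiag, Finset.mul_sum]
  refine Finset.sum_congr rfl fun α hα => ?_
  rw [Finset.mem_piAntidiag] at hα
  simp only [aMulti, multiPow, hα.1, map_prod, map_pow, mul_pow, Finset.prod_mul_distrib]
  push_cast
  ring

theorem inner_self_eq_ofReal (z : EuclideanSpace ℂ (Fin d)) :
    ⟪z, z⟫_ℂ = ((‖z‖ ^ 2 : ℝ) : ℂ) := by
  rw [inner_self_eq_norm_sq_to_K]
  push_cast
  rfl

theorem summable_weights {z : EuclideanSpace ℂ (Fin d)}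
    (hz : z ∈ Metric.ball (0 : EuclideanSpace ℂ (Fin d)) 1) :
    Summable fun α => k.aMulti α * ‖multiPow z α‖ ^ 2 := by
  have hn : ∀ α, 0 ≤ k.aMulti α * ‖multiPow z α‖ ^ 2 := fun α =>
    mul_nonneg (k.aMulti_pos α).le (sq_nonneg _)
  have hfin : ∀ n, ∑ α ∈ Finset.piAntidiag Finset.univ n, k.aMulti α * ‖multiPow z α‖ ^ 2 =
      k.coeff n * (‖z‖ ^ 2) ^ n := by
    intro n
    have h := k.sum_piAntidiag z z n
    simp only [Complex.mul_conj', inner_self_eq_ofReal] at h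
    exact_mod_cast h
  have hs : Summable fun n => k.coeff n * (‖z‖ ^ 2) ^ n := by
    have h := k.summable z hz z hz
    simp only [inner_self_eq_ofReal] at h
    exact_mod_cast h
  refine summable_of_sum_le hn (c := ∑' n, k.coeff n * (‖z‖ ^ 2) ^ n) fun u => ?_
  classical
  calc ∑ α ∈ u, k.aMulti α * ‖multiPow z α‖ ^ 2
      = ∑ n ∈ u.image (fun α => ∑ i, α i), ∑ α ∈ u with ∑ i, α i = n,
          k.aMulti α * ‖multiPow z α‖ ^ 2 :=
        (Finset.sum_fiberwise_of_maps_to (fun α hα => Finset.mem_image_of_mem _ hα) _).symm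
    _ ≤ ∑ n ∈ u.image (fun α => ∑ i, α i), k.coeff n * (‖z‖ ^ 2) ^ n := by
        refine Finset.sum_le_sum fun n _ => ?_
        rw [← hfin n]
        refine Finset.sum_le_sum_of_subset_of_nonneg (fun α hα => ?_) fun α _ _ => hn α
        rw [Finset.mem_filter] at hα
        rw [Finset.mem_piAntidiag]
        exact ⟨hα.2, fun _ _ => Finset.mem_univ _⟩
    _ ≤ ∑' n, k.coeff n * (‖z‖ ^ 2) ^ n :=
        hs.sum_le_tsum _ fun n _ => mul_nonneg (k.coeff_pos n).le (by positivity)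

/-- `k(z, w) = ∑ a_α z ^ α conj (w ^ α)`. -/
theorem hasSum_toFun {z w : EuclideanSpace ℂ (Fin d)}
    (hz : z ∈ Metric.ball (0 : EuclideanSpace ℂ (Fin d)) 1)
    (hw : w ∈ Metric.ball (0 : EuclideanSpace ℂ (Fin d)) 1) :
    HasSum (fun α => (k.aMulti α : ℂ) * (multiPow z α * starRingEnd ℂ (multiPow w α)))
      (k.toFun z w) := by
  have hs : Summable fun α =>
      (k.aMulti α : ℂ) * (multiPow z α * starRingEnd ℂ (multiPow w α)) := by
    refine Summable.of_norm_bounded ((k.summable_weights hz).add (k.summable_weights hw))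
      fun α => ?_
    have ha := k.aMulti_pos α
    rw [norm_mul, norm_mul, Complex.norm_real, Real.norm_of_nonneg ha.le, RCLike.norm_conj,
      ← mul_add]
    refine mul_le_mul_of_nonneg_left ?_ ha.le
    nlinarith [sq_nonneg (‖multiPow z α‖ - ‖multiPow w α‖), sq_nonneg ‖multiPow z α‖,
      sq_nonneg ‖multiPow w α‖]
  have h := (hs.hasSum.tsum_fiberwise fun α => ∑ i, α i).tsum_eq
  rw [hs.hasSum_iff, ← h, toFun]
  refine tsum_congr fun n => ?_
  rw [← k.sum_piAntidiag z w n, ← Finset.tsum_subtype]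
  have he : (fun α : Fin d → ℕ => ∑ i, α i) ⁻¹' {n} =
      (Finset.piAntidiag Finset.univ n : Finset (Fin d → ℕ)) := by
    ext α
    simp
  rw [he]
  rfl

theorem summable_apply (f : k.HSpace E) {z : EuclideanSpace ℂ (Fin d)}
    (hz : z ∈ Metric.ball (0 : EuclideanSpace ℂ (Fin d)) 1) :
    Summable fun α => ‖multiPow z α • k.taylorCoeff f α‖ := by
  refine Summable.of_nonneg_of_le (fun α => norm_nonneg _) (fun α => ?_)
    ((k.summable_weights hz).add (k.summable_seq f))
  have ha := (k.aMulti_pos α).le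
  rw [taylorCoeff, norm_smul, norm_smul, Complex.norm_real,
    Real.norm_of_nonneg (Real.sqrt_nonneg _)]
  have h2 := Real.sq_sqrt ha
  rw [← h2, Real.sqrt_sq (Real.sqrt_nonneg _)]
  nlinarith [sq_nonneg (√(k.aMulti α) * ‖multiPow z α‖ - ‖(HSpace.seq k f) α‖),
    sq_nonneg (√(k.aMulti α) * ‖multiPow z α‖), sq_nonneg ‖(HSpace.seq k f) α‖]

section Complete

variable [CompleteSpace E]

/-- Evaluation of an element of `H_k(E)` at a point of the ball, `f(z) = ∑ z ^ α • c_α`. -/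
def evalCLM (z : Metric.ball (0 : EuclideanSpace ℂ (Fin d)) 1) : k.HSpace E →L[ℂ] E :=
  LinearMap.mkContinuous
    { toFun := fun f => ∑' α, multiPow z.1 α • k.taylorCoeff f α
      map_add' := fun f g => by
        rw [← (k.summable_apply f z.2).of_norm.tsum_add (k.summable_apply g z.2).of_norm]
        simp only [taylorCoeff_add, smul_add]
      map_smul' := fun c f => by
        rw [RingHom.id_apply, ← (k.summable_apply f z.2).of_norm.tsum_const_smul]
        simp only [taylorCoeff_smul, smul_comm c] }
    ((∑' α, (√(k.aMulti α) * ‖multiPow z.1 α‖) ^ 2) ^ (1 / 2 : ℝ)) (fun f => by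
      have hw : (fun α => (√(k.aMulti α) * ‖multiPow z.1 α‖) ^ 2) =
          fun α => k.aMulti α * ‖multiPow z.1 α‖ ^ 2 := by
        funext α
        rw [mul_pow, Real.sq_sqrt (k.aMulti_pos α).le]
      have h := Real.inner_le_Lp_mul_Lq_tsum_of_nonneg (p := 2) (q := 2)
        Real.HolderConjugate.two_two
        (f := fun α => √(k.aMulti α) * ‖multiPow z.1 α‖) (g := fun α => ‖(HSpace.seq k f) α‖)
        (fun α => by positivity) (fun α => norm_nonneg _)
        (by
          simp only [Real.rpow_two]
          rw [hw]
          exact k.summable_weights z.2)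
        (by simpa only [Real.rpow_two] using k.summable_seq f)
      simp only [Real.rpow_two] at h
      rw [← norm_sq_eq_tsum_seq, ← Real.sqrt_eq_rpow (‖f‖ ^ 2), Real.sqrt_sq (norm_nonneg f)] at h
      refine (norm_tsum_le_tsum_norm (k.summable_apply f z.2)).trans (le_of_eq_of_le ?_ h)
      refine tsum_congr fun α => ?_
      rw [taylorCoeff, norm_smul, norm_smul, Complex.norm_real,
        Real.norm_of_nonneg (Real.sqrt_nonneg _)]
      ring)

theorem hasSum_evalCLM (z : Metric.ball (0 : EuclideanSpace ℂ (Fin d)) 1) (f : k.HSpace E) :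
    HasSum (fun α => multiPow z.1 α • k.taylorCoeff f α) (k.evalCLM z f) :=
  (k.summable_apply f z.2).of_norm.hasSum

theorem evalCLM_injective {f : k.HSpace E} (h : ∀ z, k.evalCLM z f = 0) : f = 0 := by
  refine k.ext_taylorCoeff fun α => ?_
  have h0 : k.taylorCoeff (0 : k.HSpace E) α = 0 := smul_zero _
  rw [h0]
  refine eq_zero_of_hasSum_zero (r := 1 / (d + 1 : ℝ)) (by positivity) (k.taylorCoeff f)
    (fun z hz => ?_) α
  have hd : (0 : ℝ) < d + 1 := by positivity
  have hmem : WithLp.toLp 2 z ∈ Metric.ball (0 : EuclideanSpace ℂ (Fin d)) 1 := by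
    rw [mem_ball_zero_iff, EuclideanSpace.norm_eq, Real.sqrt_lt' one_pos]
    calc ∑ i, ‖z i‖ ^ 2 ≤ ∑ _i : Fin d, (1 / (d + 1 : ℝ)) ^ 2 :=
          Finset.sum_le_sum fun i _ => pow_le_pow_left₀ (norm_nonneg _) (hz i).le 2
      _ = d * (1 / (d + 1 : ℝ)) ^ 2 := by simp
      _ < 1 ^ 2 := by
        rw [div_pow, one_pow, mul_one_div, div_lt_one (by positivity)]
        nlinarith [(Nat.cast_nonneg d : (0 : ℝ) ≤ d)]
  have h1 := k.hasSum_evalCLM ⟨_, hmem⟩ f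
  rw [h] at h1
  exact h1

/-- `H_k(E)` is a space of `E`-valued functions on the unit ball. -/
instance : RKHS ℂ (k.HSpace E) (Metric.ball (0 : EuclideanSpace ℂ (Fin d)) 1) E where
  coeCLM := ContinuousLinearMap.pi fun z => k.evalCLM z
  coeCLM_injective f g h := by
    refine sub_eq_zero.1 (k.evalCLM_injective fun z => ?_)
    rw [map_sub, sub_eq_zero]
    exact congrFun h z

theorem hasSum_apply (f : k.HSpace E) (z : Metric.ball (0 : EuclideanSpace ℂ (Fin d)) 1) :
    HasSum (fun α => multiPow z.1 α • k.taylorCoeff f α) (f z) :=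
  k.hasSum_evalCLM z f

/-- The reproducing kernel of `H_k(E)` is `k(z, w)` times the identity of `E`. -/
theorem kernel_HSpace (z w : Metric.ball (0 : EuclideanSpace ℂ (Fin d)) 1) :
    RKHS.kernel (k.HSpace E) z w = k.toFun z w • ContinuousLinearMap.id ℂ E := by
  ext x
  have hs : Summable fun α => ‖starRingEnd ℂ (multiPow w.1 α) • (k.aMulti α : ℂ) • x‖ ^ 2 /
      k.aMulti α := by
    refine ((k.summable_weights w.2).mul_left (‖x‖ ^ 2)).congr fun α => ?_
    have ha := k.aMulti_pos α
    rw [norm_smul, norm_smul, RCLike.norm_conj, Complex.norm_real, Real.norm_of_nonneg ha.le]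
    field_simp
  have hk : RKHS.kerFun (k.HSpace E) w x = k.ofTaylor _ hs := by
    refine ext_inner_right ℂ fun f => ?_
    rw [RKHS.kerFun_inner]
    have h1 := (k.hasSum_apply f w).mapL (innerSL ℂ x)
    have h2 := lp.hasSum_inner (𝕜 := ℂ) (HSpace.seq k (k.ofTaylor _ hs)) (HSpace.seq k f)
    refine h1.unique (h2.congr_fun fun α => ?_)
    change ⟪x, multiPow w.1 α • ((√(k.aMulti α) : ℝ) : ℂ) • (HSpace.seq k f) α⟫_ℂ =
      ⟪(((√(k.aMulti α))⁻¹ : ℝ) : ℂ) • starRingEnd ℂ (multiPow w.1 α) • (k.aMulti α : ℂ) • x,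
        (HSpace.seq k f) α⟫_ℂ
    have ha := k.aMulti_pos α
    have hsq : (((√(k.aMulti α))⁻¹ : ℝ) : ℂ) * (k.aMulti α : ℂ) = ((√(k.aMulti α) : ℝ) : ℂ) := by
      rw [← Complex.ofReal_mul, inv_mul_eq_div, Real.div_sqrt]
    simp only [inner_smul_left, inner_smul_right, Complex.conj_ofReal, RingHomCompTriple.comp_apply,
      RingHom.id_apply]
    rw [← hsq]
    ring
  rw [← RKHS.kerFun_apply, hk]
  have h1 := k.hasSum_apply (k.ofTaylor _ hs) z
  simp only [taylorCoeff_ofTaylor] at h1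
  have h2 := (k.hasSum_toFun z.2 w.2).smul_const x
  refine h1.unique (h2.congr_fun fun α => ?_)
  simp only [smul_smul]
  congr 1
  ring

end Complete

end HSpace

/-! ### `1/k`-contractions -/

section Operators

variable {H : Type*} [NormedAddCommGroup H] [InnerProductSpace ℂ H] [CompleteSpace H]

/-- `S = ∑_{α ≠ 0} b_α T ^ α (T ^ α)*` in the strong operator topology. -/
def HasDefectSum (T : Fin d → H →L[ℂ] H) (S : H →L[ℂ] H) : Prop :=
  ∀ x, HasSum (fun α : {α : Fin d → ℕ // α ≠ 0} =>
    (k.bMulti α.1 : ℂ) • (tuplePow T α.1 ((tuplePow T α.1).adjoint x))) (S x)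

/-- `T` is a commuting tuple for which `∑_{α ≠ 0} b_α T ^ α (T ^ α)*` converges strongly to a
contraction. -/
def IsInvContraction (T : Fin d → H →L[ℂ] H) : Prop :=
  (∀ i j, Commute (T i) (T j)) ∧ ∃ S : H →L[ℂ] H, k.HasDefectSum T S ∧ ‖S‖ ≤ 1

open Classical in
/-- The strong sum `∑_{α ≠ 0} b_α T ^ α (T ^ α)*`, with value `0` if it does not exist. -/
def defectSum (T : Fin d → H →L[ℂ] H) : H →L[ℂ] H :=
  if h : ∃ S, k.HasDefectSum T S then h.choose else 0

/-- `Δ_T = (I - ∑_{α ≠ 0} b_α T ^ α (T ^ α)*) ^ (1 / 2)`. -/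
def defect (T : Fin d → H →L[ℂ] H) : H →L[ℂ] H :=
  CFC.sqrt (1 - k.defectSum T)

variable {k} in
theorem HasDefectSum.defectSum_eq {T : Fin d → H →L[ℂ] H} {S : H →L[ℂ] H}
    (h : k.HasDefectSum T S) : k.defectSum T = S := by
  have he : ∃ S, k.HasDefectSum T S := ⟨S, h⟩
  rw [defectSum, dif_pos he]
  ext x
  exact (he.choose_spec x).unique (h x)

variable {k} in
theorem IsInvContraction.one_sub_defectSum_nonneg {T : Fin d → H →L[ℂ] H}
    (hT : k.IsInvContraction T) : 0 ≤ 1 - k.defectSum T := by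
  obtain ⟨-, S, hS, hS1⟩ := hT
  rw [hS.defectSum_eq, ContinuousLinearMap.nonneg_iff_isPositive]
  have hsymm : ∀ x y, ⟪S x, y⟫_ℂ = ⟪x, S y⟫_ℂ := by
    intro x y
    have h1 := ((hS x).mapL (innerSLFlip ℂ y))
    have h2 := ((hS y).mapL (innerSL ℂ x))
    refine h1.unique (h2.congr_fun fun α => ?_)
    change ⟪(k.bMulti α.1 : ℂ) • _, y⟫_ℂ = ⟪x, (k.bMulti α.1 : ℂ) • _⟫_ℂ
    rw [inner_smul_left, inner_smul_right, Complex.conj_ofReal,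
      ← ContinuousLinearMap.adjoint_inner_right, ContinuousLinearMap.adjoint_inner_left]
  refine ⟨fun x y => ?_, fun x => ?_⟩
  · change ⟪x - S x, y⟫_ℂ = ⟪x, y - S y⟫_ℂ
    rw [inner_sub_left, inner_sub_right, hsymm]
  · change 0 ≤ RCLike.re ⟪x - S x, x⟫_ℂ
    rw [inner_sub_left, map_sub, sub_nonneg, inner_self_eq_norm_sq]
    calc RCLike.re ⟪S x, x⟫_ℂ ≤ ‖S x‖ * ‖x‖ := re_inner_le_norm _ _
      _ ≤ 1 * ‖x‖ * ‖x‖ := by gcongr; exact S.le_of_opNorm_le hS1 x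
      _ = ‖x‖ ^ 2 := by ring

theorem defect_nonneg (T : Fin d → H →L[ℂ] H) : 0 ≤ k.defect T :=
  CFC.sqrt_nonneg _

variable {k} in
theorem IsInvContraction.defect_mul_self {T : Fin d → H →L[ℂ] H} (hT : k.IsInvContraction T) :
    k.defect T * k.defect T = 1 - k.defectSum T :=
  CFC.sqrt_mul_sqrt_self _ hT.one_sub_defectSum_nonneg

/-- A `1/k`-contraction is pure if `∑ a_α T ^ α Δ_T² (T ^ α)* = I` in the strong operator
topology. -/
def IsPureInvContraction (T : Fin d → H →L[ℂ] H) : Prop :=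
  k.IsInvContraction T ∧ ∀ x, HasSum (fun α : Fin d → ℕ =>
    (k.aMulti α : ℂ) •
      (tuplePow T α (k.defect T (k.defect T ((tuplePow T α).adjoint x))))) x

/-- The closure of the range of `Δ_T`. -/
abbrev defectSpace (T : Fin d → H →L[ℂ] H) : Submodule ℂ H :=
  (LinearMap.range (k.defect T).toLinearMap).topologicalClosure

/-- `Δ_T` as an operator into the closure of its range. -/
def defectTo (T : Fin d → H →L[ℂ] H) : H →L[ℂ] k.defectSpace T :=
  (k.defect T).codRestrict _ fun x => Submodule.le_topologicalClosure _ ⟨x, rfl⟩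

/-- The Taylor coefficients `a_α Δ_T (T ^ α)* x` of `V_T x`. -/
def poissonCoeff (T : Fin d → H →L[ℂ] H) (x : H) (α : Fin d → ℕ) : k.defectSpace T :=
  (k.aMulti α : ℂ) • k.defectTo T ((tuplePow T α).adjoint x)

variable {k} in
theorem IsPureInvContraction.hasSum_norm_sq {T : Fin d → H →L[ℂ] H}
    (hT : k.IsPureInvContraction T) (x : H) :
    HasSum (fun α => ‖k.poissonCoeff T x α‖ ^ 2 / k.aMulti α) (‖x‖ ^ 2) := by
  have h := ((hT.2 x).mapL (innerSL ℂ x)).mapL Complex.reCLM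
  have hx : Complex.reCLM (innerSL ℂ x x) = ‖x‖ ^ 2 := by
    change RCLike.re ⟪x, x⟫_ℂ = _
    exact inner_self_eq_norm_sq x
  rw [hx] at h
  refine h.congr_fun fun α => ?_
  have ha := k.aMulti_pos α
  have hsa : ∀ y z, ⟪k.defect T y, z⟫_ℂ = ⟪y, k.defect T z⟫_ℂ :=
    ((ContinuousLinearMap.nonneg_iff_isPositive _).1 (k.defect_nonneg T)).1
  change _ = RCLike.re ⟪x, (k.aMulti α : ℂ) •
      (tuplePow T α (k.defect T (k.defect T ((tuplePow T α).adjoint x))))⟫_ℂ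
  rw [inner_smul_right, ← ContinuousLinearMap.adjoint_inner_left, ← hsa]
  have h1 : ‖k.poissonCoeff T x α‖ = k.aMulti α * ‖k.defect T ((tuplePow T α).adjoint x)‖ := by
    rw [poissonCoeff, norm_smul, Complex.norm_real, Real.norm_of_nonneg ha.le]
    rfl
  have h2 := Complex.re_ofReal_mul (k.aMulti α)
    ⟪k.defect T ((tuplePow T α).adjoint x), k.defect T ((tuplePow T α).adjoint x)⟫_ℂ
  have h3 : (⟪k.defect T ((tuplePow T α).adjoint x),
      k.defect T ((tuplePow T α).adjoint x)⟫_ℂ).re = _ :=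
    inner_self_eq_norm_sq (𝕜 := ℂ) _
  rw [h3] at h2
  refine Eq.trans ?_ h2.symm
  rw [h1]
  field_simp

variable {k} in
/-- The isometry `V_T : H → H_k(closure of ran Δ_T)`, `V_T x = ∑ a_α z ^ α ⊗ Δ_T (T ^ α)* x`, of a
pure `1/k`-contraction `T`. -/
def IsPureInvContraction.poisson {T : Fin d → H →L[ℂ] H} (hT : k.IsPureInvContraction T) :
    H →ₗᵢ[ℂ] k.HSpace (k.defectSpace T) where
  toFun x := k.ofTaylor (k.poissonCoeff T x) (hT.hasSum_norm_sq x).summable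
  map_add' x y := k.ext_taylorCoeff fun α => by
    simp [taylorCoeff_add, poissonCoeff]
  map_smul' c x := k.ext_taylorCoeff fun α => by
    simp [taylorCoeff_smul, poissonCoeff, smul_comm c]
  norm_map' x := by
    rw [← sq_eq_sq₀ (norm_nonneg _) (norm_nonneg _)]
    change ‖k.ofTaylor (k.poissonCoeff T x) (hT.hasSum_norm_sq x).summable‖ ^ 2 = _
    rw [norm_sq_eq_tsum]
    simp only [taylorCoeff_ofTaylor]
    exact (hT.hasSum_norm_sq x).tsum_eq

/-! ### Characteristic functions -/

/-- A pure `1/k`-contraction `T` admits a characteristic function through `l`: there are a Hilbert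
space `E` and an analytic function `θ` from the ball to `B(E, closure of ran Δ_T)` such that
multiplication by `θ` is a bounded operator `M` from `H_l ⊗ E` to `H_k ⊗ closure of ran Δ_T` with
`I - V_T V_T* = M M*`. -/
def AdmitsCharFunction {T : Fin d → H →L[ℂ] H} (hT : k.IsPureInvContraction T) : Prop :=
  ∃ (E : Type v) (_ : NormedAddCommGroup E) (_ : InnerProductSpace ℂ E) (_ : CompleteSpace E)
    (θ : EuclideanSpace ℂ (Fin d) → E →L[ℂ] k.defectSpace T)
    (M : l.HSpace E →L[ℂ] k.HSpace (k.defectSpace T)),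
    AnalyticOnNhd ℂ θ (Metric.ball 0 1) ∧
    (∀ (f : l.HSpace E) (z : Metric.ball (0 : EuclideanSpace ℂ (Fin d)) 1),
      (M f) z = θ z (f z)) ∧
    1 - hT.poisson.toContinuousLinearMap ∘L hT.poisson.toContinuousLinearMap.adjoint =
      M ∘L M.adjoint

end Operators

/-- The kernel `k` admits a characteristic function through the kernel `l`: every pure
`1/k`-contraction does. -/
def AdmitsCharFunctionThrough : Prop :=
  ∀ (H : Type u) [NormedAddCommGroup H] [InnerProductSpace ℂ H] [CompleteSpace H]
    (T : Fin d → H →L[ℂ] H) (hT : k.IsPureInvContraction T),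
    AdmitsCharFunction.{v} k l hT

end UnitarilyInvariantKernel

end

noncomputable section

/-! A single test tuple suffices. Write `k` for the target kernel, with coefficients `a_j`, and `l`
for the source kernel. Let `A` be the compression of multiplication by `z₁` on `H_k` to the span of
`1, z₁, …, z₁ ^ (N - 1)`, and let `T = (A, 0, …, 0)`. The identity `(1 - 1/∑ a_j t^j) ∑ a_j t^j = ∑
a_j t^j - 1` makes `T` a pure `1/k`-contraction whose defect operator is the projection onto the
constants, spanned by a unit vector `v`. The isometry `V_T` is the inclusion of the span in `H_k`,
so on the normalized powers `√a_j z₁^j v` the projection `I - V_T V_T*` is zero for `j < N` and the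
identity for `j ≥ N`.

Suppose this projection equals `M M*` with `M` multiplication by `θ`. Then `M*` kills the normalized
powers below `N` and preserves the norm of the others. Since `M` commutes with multiplication by
monomials, the vanishing below `N` forces `M* (√a_N z₁^N v)` to be a constant `e`, of norm one, and
the coefficient of `θ e` at `z₁^N` has `v`-component `√a_N`. Multiplying by the normalized monomial
`√(l.coeff 1) z₁` moves this coefficient to `z₁^(N + 1)`. Cauchy–Schwarz against `M* (√a_(N+1)
z₁^(N+1) v)`, again of norm one, gives `l.coeff 1 * a_N ≤ a_(N+1)`: see
`coeff_one_mul_le_of_multiplier` and `AdmitsCharFunction.coeff_one_mul_le`.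

For Bergman kernels `l.coeff 1 = n`, and the choice `N = m` gives `a_(m+1) / a_m = 2m / (m + 1) <
2`. Hence `n < 2`. -/

theorem toLp_mem_ball {d : ℕ} {z : Fin d → ℂ} (hz : ∀ i, ‖z i‖ < 1 / (d + 1 : ℝ)) :
    WithLp.toLp 2 z ∈ Metric.ball (0 : EuclideanSpace ℂ (Fin d)) 1 := by
  have hd : (0 : ℝ) < d + 1 := by positivity
  rw [mem_ball_zero_iff, EuclideanSpace.norm_eq, Real.sqrt_lt' one_pos]
  calc ∑ i, ‖z i‖ ^ 2 ≤ ∑ _i : Fin d, (1 / (d + 1 : ℝ)) ^ 2 :=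
        Finset.sum_le_sum fun i _ => pow_le_pow_left₀ (norm_nonneg _) (hz i).le 2
    _ = d * (1 / (d + 1 : ℝ)) ^ 2 := by simp
    _ < 1 ^ 2 := by
      rw [div_pow, one_pow, mul_one_div, div_lt_one (by positivity)]
      nlinarith [(Nat.cast_nonneg d : (0 : ℝ) ≤ d)]

theorem multiPow_add {d : ℕ} (z : EuclideanSpace ℂ (Fin d)) (α β : Fin d → ℕ) :
    multiPow z (α + β) = multiPow z α * multiPow z β := by
  simp [multiPow, pow_add, Finset.prod_mul_distrib]

@[simp]
theorem multiPow_zero {d : ℕ} (z : EuclideanSpace ℂ (Fin d)) : multiPow z 0 = 1 := by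
  simp [multiPow]

namespace UnitarilyInvariantKernel

variable {d : ℕ} (k l : UnitarilyInvariantKernel d)

theorem aMulti_single (i : Fin d) (j : ℕ) : k.aMulti (Pi.single i j) = k.coeff j := by
  simp [aMulti, Nat.multinomial, Pi.single_apply, Finset.prod_ite_eq', apply_ite,
    Nat.div_self (Nat.factorial_pos _)]

theorem aMulti_zero : k.aMulti 0 = 1 := by
  simp [aMulti, Nat.multinomial, k.coeff_zero]

/-! ### Normalized monomials, multipliers, and the coefficient inequality. -/

section Monomial

variable {E : Type*} [NormedAddCommGroup E] [InnerProductSpace ℂ E]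

/-- The normalized monomial `√(a_α) * z ^ α • e` in `H_k(E)`. -/
def monomial (α : Fin d → ℕ) (e : E) : k.HSpace E :=
  (lp.single 2 α e : lp (fun _ : Fin d → ℕ => E) 2)

theorem seq_monomial (α : Fin d → ℕ) (e : E) (β : Fin d → ℕ) :
    HSpace.seq k (k.monomial α e) β = Pi.single (M := fun _ => E) α e β :=
  lp.single_apply (E := fun _ : Fin d → ℕ => E) 2 α e β

theorem norm_monomial (α : Fin d → ℕ) (e : E) : ‖k.monomial α e‖ = ‖e‖ :=
  lp.norm_single (E := fun _ : Fin d → ℕ => E) (by norm_num) α e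

theorem inner_monomial_left [CompleteSpace E] (α : Fin d → ℕ) (e : E) (f : k.HSpace E) :
    ⟪k.monomial α e, f⟫_ℂ = ⟪e, HSpace.seq k f α⟫_ℂ :=
  lp.inner_single_left (G := fun _ : Fin d → ℕ => E) α e f

theorem ext_seq {f g : k.HSpace E} (h : ∀ α, HSpace.seq k f α = HSpace.seq k g α) : f = g :=
  lp.ext (funext h)

theorem monomial_apply [CompleteSpace E] (α : Fin d → ℕ) (e : E)
    (z : Metric.ball (0 : EuclideanSpace ℂ (Fin d)) 1) :
    k.monomial α e z = (((√(k.aMulti α) : ℝ) : ℂ) * multiPow z.1 α) • e := by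
  have h := k.hasSum_apply (k.monomial α e) z
  refine h.unique ?_
  convert hasSum_single α ?_ using 1
  · rw [taylorCoeff, seq_monomial, Pi.single_eq_same, smul_smul, mul_comm]
  · intro β hβ
    rw [taylorCoeff, seq_monomial, Pi.single_eq_of_ne hβ, smul_zero, smul_zero]

/-- Taylor coefficients of a product with a monomial are shifted. -/
theorem taylorCoeff_of_eq_mul_multiPow [CompleteSpace E] {F G : k.HSpace E} {c : ℂ}
    {β : Fin d → ℕ}
    (h : ∀ z : Metric.ball (0 : EuclideanSpace ℂ (Fin d)) 1, F z = (c * multiPow z.1 β) • G z)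
    (γ : Fin d → ℕ) [Decidable (β ≤ γ)] :
    k.taylorCoeff F γ = if β ≤ γ then c • k.taylorCoeff G (γ - β) else 0 := by
  classical
  -- Both sides are coefficient families of the same function on a polydisc inside the ball, so
  -- their difference vanishes.
  have key := eq_zero_of_hasSum_zero (r := 1 / (d + 1 : ℝ)) (by positivity)
    (fun γ => k.taylorCoeff F γ - if β ≤ γ then c • k.taylorCoeff G (γ - β) else 0) ?_ γ
  · rw [sub_eq_zero] at key
    convert key
  intro z hz
  have h1 := k.hasSum_apply F ⟨_, toLp_mem_ball hz⟩
  have h2 := (k.hasSum_apply G ⟨_, toLp_mem_ball hz⟩).const_smul (c * multiPow (WithLp.toLp 2 z) β)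
  rw [← h ⟨_, toLp_mem_ball hz⟩] at h2
  have h3 : HasSum (fun γ => multiPow (WithLp.toLp 2 z) γ •
      if β ≤ γ then c • k.taylorCoeff G (γ - β) else 0) (F ⟨_, toLp_mem_ball hz⟩) := by
    -- Reindex along `δ ↦ δ + β`; exponents outside its image are exactly those not above `β`.
    rw [← (add_left_injective β).hasSum_iff]
    · refine h2.congr_fun fun δ => ?_
      simp only [Function.comp_apply, multiPow_add, smul_smul]
      rw [if_pos (le_add_of_nonneg_left zero_le), add_tsub_cancel_right, smul_smul]
      congr 1
      ring
    · intro γ hγ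
      rw [if_neg, smul_zero]
      exact fun hle => hγ ⟨γ - β, tsub_add_cancel_of_le hle⟩
  have h4 := h1.sub h3
  rw [sub_self] at h4
  refine h4.congr_fun fun γ => ?_
  rw [smul_sub]
  rfl

/-- A multiplier commutes with multiplication by `z ^ β`, so it is determined by its values on
constants; `√(l.aMulti β)` comes from the normalization of the monomial in `H_l`. -/
theorem taylorCoeff_multiplier_monomial [CompleteSpace E] {D : Type*} [NormedAddCommGroup D]
    [InnerProductSpace ℂ D] [CompleteSpace D] {θ : EuclideanSpace ℂ (Fin d) → E →L[ℂ] D}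
    {M : l.HSpace E →L[ℂ] k.HSpace D}
    (hM : ∀ (f : l.HSpace E) (z : Metric.ball (0 : EuclideanSpace ℂ (Fin d)) 1),
      (M f) z = θ z (f z)) (β γ : Fin d → ℕ) [Decidable (β ≤ γ)] (e : E) :
    k.taylorCoeff (M (l.monomial β e)) γ =
      if β ≤ γ then ((√(l.aMulti β) : ℝ) : ℂ) • k.taylorCoeff (M (l.monomial 0 e)) (γ - β)
      else 0 := by
  refine k.taylorCoeff_of_eq_mul_multiPow (fun z => ?_) γ
  rw [hM, hM, monomial_apply, monomial_apply, map_smul, map_smul, aMulti_zero]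
  simp

theorem inner_taylorCoeff [CompleteSpace E] (f : k.HSpace E) (e : E) (γ : Fin d → ℕ) :
    ⟪e, k.taylorCoeff f γ⟫_ℂ = ((√(k.aMulti γ) : ℝ) : ℂ) * ⟪k.monomial γ e, f⟫_ℂ := by
  rw [inner_monomial_left, taylorCoeff, inner_smul_right]

/-- If the adjoint of a multiplier from `H_l` to `H_k` kills `z_i ^ j` for `j < N`, is isometric at
`z_i ^ N` and contractive at `z_i ^ (N + 1)`, then the first coefficient of `l` is at most
`a_{N + 1} / a_N`. -/
theorem coeff_one_mul_le_of_multiplier [CompleteSpace E] {D : Type*} [NormedAddCommGroup D]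
    [InnerProductSpace ℂ D] [CompleteSpace D] {θ : EuclideanSpace ℂ (Fin d) → E →L[ℂ] D}
    {M : l.HSpace E →L[ℂ] k.HSpace D}
    (hM : ∀ (f : l.HSpace E) (z : Metric.ball (0 : EuclideanSpace ℂ (Fin d)) 1),
      (M f) z = θ z (f z)) (i : Fin d) (N : ℕ) (v : D)
    (h0 : ∀ j < N, M.adjoint (k.monomial (Pi.single i j) v) = 0)
    (h1 : ‖M.adjoint (k.monomial (Pi.single i N) v)‖ = 1)
    (h2 : ‖M.adjoint (k.monomial (Pi.single i (N + 1)) v)‖ ≤ 1) :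
    l.coeff 1 * k.coeff N ≤ k.coeff (N + 1) := by
  classical
  -- The vanishing of `M*` below `N`, read as a statement about `θ e`: its coefficients at `z_i ^ j`
  -- are orthogonal to `v`.
  have hc : ∀ j < N, ∀ e, ⟪v, k.taylorCoeff (M (l.monomial 0 e)) (Pi.single i j)⟫_ℂ = 0 := by
    intro j hj e
    rw [inner_taylorCoeff, ← ContinuousLinearMap.adjoint_inner_left, h0 j hj, inner_zero_left,
      mul_zero]
  set g := M.adjoint (k.monomial (Pi.single i N) v) with hg
  have hsq : ∀ α, ((√(k.aMulti α) : ℝ) : ℂ) ≠ 0 := fun α =>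
    Complex.ofReal_ne_zero.2 (Real.sqrt_pos.2 (k.aMulti_pos α)).ne'
  -- `g` is constant: pairing it with `z ^ β e` gives a coefficient of `θ e` at exponent `N - β i`
  -- on the axis, which is below `N`.
  have hgs : ∀ β, β ≠ 0 → HSpace.seq l g β = 0 := by
    intro β hβ
    refine ext_inner_left ℂ fun e => ?_
    rw [inner_zero_right, ← inner_monomial_left, hg, ContinuousLinearMap.adjoint_inner_right]
    rw [← inner_conj_symm, map_eq_zero]
    refine (mul_eq_zero.1 (?_ : ((√(k.aMulti (Pi.single i N)) : ℝ) : ℂ) * _ = 0)).resolve_left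
      (hsq _)
    rw [← inner_taylorCoeff, k.taylorCoeff_multiplier_monomial l hM]
    split_ifs with hle
    -- An exponent below a multiple of the `i`-th unit vector lies on the same axis.
    · have hsub : Pi.single i N - β = Pi.single i (N - β i) := by
        funext t
        by_cases ht : t = i
        · subst ht; simp
        · have := hle t
          simp [ht]
      have hpos : 0 < β i := by
        rw [Nat.pos_iff_ne_zero]
        intro h
        refine hβ (funext fun t => ?_)
        by_cases ht : t = i
        · subst ht; exact h
        · have := hle t
          simpa [ht] using this
      have hN : β i ≤ N := by simpa using hle i
      rw [inner_smul_right, hsub, hc _ (by omega), mul_zero]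
    · exact inner_zero_right _
  set e := HSpace.seq l g 0 with he
  have hge : g = l.monomial 0 e := by
    refine l.ext_seq fun β => ?_
    rw [seq_monomial]
    by_cases hβ : β = 0
    · subst hβ; rw [Pi.single_eq_same]
    · rw [Pi.single_eq_of_ne hβ, hgs β hβ]
  have hne : ‖e‖ = 1 := by rw [← l.norm_monomial 0 e, ← hge, h1]
  have hφ : ⟪v, k.taylorCoeff (M (l.monomial 0 e)) (Pi.single i N)⟫_ℂ = ((√(k.coeff N) : ℝ) : ℂ) := by
    rw [inner_taylorCoeff, ← ContinuousLinearMap.adjoint_inner_left, ← hg, ← hge,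
      inner_self_eq_norm_sq_to_K, h1, aMulti_single]
    simp
  -- The coefficient of `M (√(l.coeff 1) z_i e)` at `z_i ^ (N + 1)`, along `v`, computed both as an
  -- inner product and by shifting.
  have hsucc : ((√(k.coeff (N + 1)) : ℝ) : ℂ) *
      ⟪M.adjoint (k.monomial (Pi.single i (N + 1)) v), l.monomial (Pi.single i 1) e⟫_ℂ =
      ((√(l.coeff 1) * √(k.coeff N) : ℝ) : ℂ) := by
    rw [ContinuousLinearMap.adjoint_inner_left, ← k.aMulti_single i (N + 1), ← inner_taylorCoeff,
      k.taylorCoeff_multiplier_monomial l hM, if_pos (Pi.single_le_single.2 (by omega)),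
      show (Pi.single i (N + 1) - Pi.single i 1 : Fin d → ℕ) = Pi.single i N by
        funext t; by_cases ht : t = i <;> simp [ht], inner_smul_right, hφ, aMulti_single]
    push_cast
    rfl
  have hle := norm_inner_le_norm (𝕜 := ℂ) (M.adjoint (k.monomial (Pi.single i (N + 1)) v))
    (l.monomial (Pi.single i 1) e)
  rw [norm_monomial, hne, mul_one] at hle
  have hn := congrArg norm hsucc
  rw [norm_mul, Complex.norm_real, Complex.norm_real, Real.norm_of_nonneg (Real.sqrt_nonneg _),
    Real.norm_of_nonneg (by positivity)] at hn
  have hfin : √(l.coeff 1) * √(k.coeff N) ≤ √(k.coeff (N + 1)) := by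
    rw [← hn]
    exact mul_le_of_le_one_right (Real.sqrt_nonneg _) (hle.trans h2)
  rw [← Real.sqrt_mul (l.coeff_pos 1).le] at hfin
  exact (Real.sqrt_le_sqrt_iff (k.coeff_pos _).le).1 hfin

end Monomial


/-! ### The coefficients of `1 - 1/k`. -/

theorem bCoeff_zero {d : ℕ} (k : UnitarilyInvariantKernel d) : k.bCoeff 0 = 0 := by
  simp [bCoeff, k.coeff_zero]

theorem bMulti_zero {d : ℕ} (k : UnitarilyInvariantKernel d) : k.bMulti 0 = 0 := by
  simp [bMulti, bCoeff_zero]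

theorem bMulti_single {d : ℕ} (k : UnitarilyInvariantKernel d) (i : Fin d) (j : ℕ) :
    k.bMulti (Pi.single i j) = k.bCoeff j := by
  simp [bMulti, Nat.multinomial_single]

/-- Compare coefficients in `(1 - 1/A) A = A - 1`, where `A = ∑ a_j t^j`. This convolution is what
makes the defect of the truncated shift a projection. -/
theorem sum_bCoeff_mul_coeff {d : ℕ} (k : UnitarilyInvariantKernel d) (n : ℕ) :
    ∑ j ∈ Finset.range (n + 1), k.bCoeff j * k.coeff (n - j) =
      if n = 0 then 0 else k.coeff n := by
  have h : (1 - (PowerSeries.mk k.coeff)⁻¹) * PowerSeries.mk k.coeff =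
      PowerSeries.mk k.coeff - 1 := by
    rw [sub_mul, one_mul, PowerSeries.inv_mul_cancel _ (by simp [k.coeff_zero])]
  have h1 := congrArg (PowerSeries.coeff n) h
  rw [PowerSeries.coeff_mul, Finset.Nat.sum_antidiagonal_eq_sum_range_succ_mk] at h1
  simp only [PowerSeries.coeff_mk, map_sub, PowerSeries.coeff_one] at h1
  rw [← sub_eq_iff_eq_add.2 (sub_add_cancel _ _).symm] at h1
  simp only [bCoeff, map_sub, PowerSeries.coeff_one]
  refine h1.trans ?_
  split_ifs with hn
  · subst hn; simp [k.coeff_zero]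
  · simp

/-! ### Weighted backward shifts on a finite orthonormal system. -/

section Truncated

variable {H : Type*} [NormedAddCommGroup H] [InnerProductSpace ℂ H]

/-- `e 0, …, e (N - 1)` is a complete orthonormal system, continued by zeros. -/
structure IsTruncatedBasis (e : ℕ → H) (N : ℕ) : Prop where
  inner_eq : ∀ i j, ⟪e i, e j⟫_ℂ = if i = j ∧ i < N then 1 else 0
  ext : ∀ x y, (∀ k, ⟪e k, x⟫_ℂ = ⟪e k, y⟫_ℂ) → x = y

theorem IsTruncatedBasis.eq_zero {e : ℕ → H} {N : ℕ} (he : IsTruncatedBasis e N) {k : ℕ}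
    (hk : N ≤ k) : e k = 0 := by
  rw [← inner_self_eq_zero (𝕜 := ℂ), he.inner_eq, if_neg (by omega)]

theorem IsTruncatedBasis.norm_zero {e : ℕ → H} {N : ℕ} (he : IsTruncatedBasis e N) (hN : 0 < N) :
    ‖e 0‖ = 1 := by
  have h := inner_self_eq_norm_sq (𝕜 := ℂ) (e 0)
  rw [he.inner_eq, if_pos ⟨rfl, hN⟩, RCLike.one_re] at h
  exact (pow_eq_one_iff_of_nonneg (norm_nonneg _) two_ne_zero).1 h.symm

/-- The `j`-step backward shift `e (i + j) ↦ √(a i / a (i + j)) • e i`. -/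
def backwardShift (a : ℕ → ℝ) (e : ℕ → H) (N j : ℕ) : H →L[ℂ] H :=
  ∑ i ∈ Finset.range N, ((√(a i / a (i + j)) : ℝ) : ℂ) •
    InnerProductSpace.rankOne ℂ (e i) (e (i + j))

namespace IsTruncatedBasis

variable {a : ℕ → ℝ} {e : ℕ → H} {N : ℕ} (he : IsTruncatedBasis e N)
include he

/-- No bound on `k` is needed: continuing the basis by zeros makes both sides vanish once `k + j ≥
N`. -/
theorem inner_backwardShift (j k : ℕ) (x : H) :
    ⟪e k, backwardShift a e N j x⟫_ℂ = ((√(a k / a (k + j)) : ℝ) : ℂ) * ⟪e (k + j), x⟫_ℂ := by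
  by_cases hk : k < N
  · simp only [backwardShift, sum_apply, inner_sum,
      smul_apply, InnerProductSpace.rankOne_apply, inner_smul_right,
      he.inner_eq]
    rw [Finset.sum_eq_single k]
    · simp [hk]
    · intro i _ hi
      rw [if_neg (fun h => hi h.1.symm), mul_zero, mul_zero]
    · intro h
      exact absurd (Finset.mem_range.2 hk) h
  · rw [he.eq_zero (by omega), he.eq_zero (k := k + j) (by omega)]
    simp

theorem backwardShift_eq_zero {j : ℕ} (hj : N ≤ j) : backwardShift a e N j = 0 := by
  ext x
  refine he.ext _ _ fun k => ?_
  rw [he.inner_backwardShift, he.eq_zero (k := k + j) (by omega)]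
  simp

theorem backwardShift_basis (j k : ℕ) :
    backwardShift a e N j (e k) =
      if j ≤ k ∧ k < N then ((√(a (k - j) / a k) : ℝ) : ℂ) • e (k - j) else 0 := by
  refine he.ext _ _ fun i => ?_
  rw [he.inner_backwardShift, he.inner_eq]
  by_cases h : j ≤ k ∧ k < N
  · rw [if_pos h, inner_smul_right, he.inner_eq]
    by_cases hi : i = k - j
    · subst hi
      rw [if_pos (by omega), if_pos (by omega), Nat.sub_add_cancel h.1]
    · rw [if_neg (by omega), if_neg (by omega), mul_zero, mul_zero]
  · rw [if_neg h, if_neg (by omega), mul_zero, inner_zero_right]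

/-- The weights telescope: `(a k / a (k + j)) * (a (k + j) / a (k + j + 1)) = a k / a (k + j + 1)`.
-/
theorem backwardShift_pow (ha : ∀ k, 0 < a k) (j : ℕ) :
    backwardShift a e N 1 ^ j = backwardShift a e N j := by
  induction j with
  | zero =>
    ext x
    refine he.ext _ _ fun k => ?_
    rw [he.inner_backwardShift, add_zero, div_self (ha k).ne']
    simp
  | succ j ih =>
    rw [pow_succ, ih]
    ext x
    refine he.ext _ _ fun k => ?_
    rw [mul_apply_eq_comp, he.inner_backwardShift, he.inner_backwardShift,
      he.inner_backwardShift, ← mul_assoc, ← Complex.ofReal_mul,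
      ← Real.sqrt_mul (div_pos (ha _) (ha _)).le, div_mul_div_cancel₀ (ha _).ne', add_assoc]

theorem inner_rankOne (hN : 0 < N) (k : ℕ) (y : H) :
    ⟪e k, InnerProductSpace.rankOne ℂ (e 0) (e 0) y⟫_ℂ = if k = 0 then ⟪e 0, y⟫_ℂ else 0 := by
  rw [InnerProductSpace.rankOne_apply, inner_smul_right, he.inner_eq]
  by_cases hk : k = 0 <;> simp [hk, hN]

variable [CompleteSpace H]

theorem inner_adjoint_backwardShift (j k : ℕ) (y : H) :
    ⟪e k, (backwardShift a e N j).adjoint y⟫_ℂ =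
      if j ≤ k ∧ k < N then ((√(a (k - j) / a k) : ℝ) : ℂ) * ⟪e (k - j), y⟫_ℂ else 0 := by
  rw [ContinuousLinearMap.adjoint_inner_right, he.backwardShift_basis]
  split_ifs
  · rw [inner_smul_left, Complex.conj_ofReal]
  · exact inner_zero_left _

/-- These products are diagonal in the basis, which reduces the defect sum to a scalar identity for
each `k`. -/
theorem inner_adjoint_backwardShift_self (ha : ∀ k, 0 < a k) (j k : ℕ) (x : H) :
    ⟪e k, (backwardShift a e N j).adjoint (backwardShift a e N j x)⟫_ℂ =
      if j ≤ k then ((a (k - j) / a k : ℝ) : ℂ) * ⟪e k, x⟫_ℂ else 0 := by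
  rw [he.inner_adjoint_backwardShift]
  by_cases h : j ≤ k ∧ k < N
  · rw [if_pos h, if_pos h.1, he.inner_backwardShift, Nat.sub_add_cancel h.1, ← mul_assoc,
      ← Complex.ofReal_mul, Real.mul_self_sqrt (div_pos (ha _) (ha _)).le]
  · rw [if_neg h]
    by_cases hk : k < N
    · rw [if_neg (by omega)]
    · rw [he.eq_zero (by omega)]
      simp

theorem isStarProjection_rankOne (hN : 0 < N) :
    IsStarProjection (InnerProductSpace.rankOne ℂ (e 0) (e 0)) :=
  InnerProductSpace.isStarProjection_rankOne_self (he.norm_zero hN)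

end IsTruncatedBasis

end Truncated

/-! ### Tuples with a single nonzero entry. -/

section Tuple

variable {H : Type*} [NormedAddCommGroup H] [InnerProductSpace ℂ H]

theorem tuplePow_single_zero {d : ℕ} (A : H →L[ℂ] H) (α : Fin (d + 1) → ℕ) :
    tuplePow (Pi.single 0 A) α = if α = Pi.single 0 (α 0) then A ^ α 0 else 0 := by
  rw [tuplePow, List.ofFn_succ, List.prod_cons, Pi.single_eq_same]
  split_ifs with h
  · have : (List.ofFn fun i : Fin d =>
        (Pi.single 0 A : Fin (d + 1) → H →L[ℂ] H) i.succ ^ α i.succ) =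
        List.ofFn fun _ : Fin d => (1 : H →L[ℂ] H) := by
      congr 1
      funext i
      rw [h, Pi.single_eq_of_ne i.succ_ne_zero (M := fun _ : Fin (d + 1) => ℕ), pow_zero]
    rw [this]
    simp
  · have : ∃ i : Fin d, α i.succ ≠ 0 := by
      by_contra! hc
      refine h (funext fun t => ?_)
      refine Fin.cases (by simp) (fun i => ?_) t
      rw [hc, Pi.single_eq_of_ne i.succ_ne_zero]
    obtain ⟨i, hi⟩ := this
    rw [List.prod_eq_zero, mul_zero]
    rw [List.mem_ofFn]
    exact ⟨i, by rw [Pi.single_eq_of_ne i.succ_ne_zero, zero_pow hi]⟩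

/-- Collapses the strong operator sums of the model to finite ones: off-axis monomials contain a
factor zero, and high powers of the shift vanish by nilpotency. -/
theorem hasSum_of_single_zero {E : Type*} [AddCommMonoid E] [TopologicalSpace E]
    {d : ℕ} {f : (Fin (d + 1) → ℕ) → E} {N : ℕ}
    (h1 : ∀ α, α ≠ Pi.single 0 (α 0) → f α = 0) (h2 : ∀ j, N ≤ j → f (Pi.single 0 j) = 0) :
    HasSum f (∑ j ∈ Finset.range N, f (Pi.single 0 j)) := by
  rw [← (Pi.single_injective (M := fun _ : Fin (d + 1) => ℕ) 0).hasSum_iff]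
  · refine hasSum_sum_of_ne_finset_zero fun j hj => h2 j ?_
    simpa using hj
  · intro α hα
    refine h1 α fun h => hα ⟨α 0, h.symm⟩

end Tuple

/-! ### The truncated shift as a pure `1/k`-contraction. -/

section Model

variable {H : Type*} [NormedAddCommGroup H] [InnerProductSpace ℂ H] [CompleteSpace H]
  {d : ℕ} (k : UnitarilyInvariantKernel (d + 1))

/-- The tuple `(A, 0, …, 0)`, where `A` is the compression of multiplication by `z₁` to the span of
`1, z₁, …, z₁ ^ (N - 1)`. -/
def truncatedShift (e : ℕ → H) (N : ℕ) : Fin (d + 1) → H →L[ℂ] H :=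
  Pi.single 0 (backwardShift k.coeff e N 1).adjoint

variable {e : ℕ → H} {N : ℕ} (he : IsTruncatedBasis e N)

theorem tuplePow_truncatedShift_of_ne {α : Fin (d + 1) → ℕ} (hα : α ≠ Pi.single 0 (α 0)) :
    tuplePow (k.truncatedShift e N) α = 0 := by
  rw [truncatedShift, tuplePow_single_zero, if_neg hα]

include he

theorem tuplePow_truncatedShift_single (j : ℕ) :
    tuplePow (k.truncatedShift e N) (Pi.single 0 j) = (backwardShift k.coeff e N j).adjoint := by
  rw [truncatedShift, tuplePow_single_zero, Pi.single_eq_same, if_pos rfl,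
    ← he.backwardShift_pow k.coeff_pos j]
  exact (star_pow (backwardShift k.coeff e N 1) j).symm

/-- The sum is diagonal with entry `∑_{j ≤ i} b_j a_(i-j) / a_i` at `e i`, equal to `1` for `0 < i <
N` and to `0` for `i = 0`. -/
theorem hasDefectSum_truncatedShift (hN : 0 < N) :
    k.HasDefectSum (k.truncatedShift e N)
      (1 - InnerProductSpace.rankOne ℂ (e 0) (e 0)) := by
  intro x
  have h := hasSum_of_single_zero (N := N) (f := fun α => (k.bMulti α : ℂ) •
    (tuplePow (k.truncatedShift e N) α ((tuplePow (k.truncatedShift e N) α).adjoint x)))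
    (fun α hα => by rw [k.tuplePow_truncatedShift_of_ne hα]; simp)
    (fun j hj => by
      rw [k.tuplePow_truncatedShift_single he, he.backwardShift_eq_zero hj]; simp)
  -- Omitting `α = 0` costs nothing because `b_0 = 0`.
  have hs := (hasSum_subtype_iff_of_support_subset (s := {α : Fin (d + 1) → ℕ | α ≠ 0}) (by
    intro α hα h0
    refine hα ?_
    simp only [h0, bMulti_zero, Complex.ofReal_zero, zero_smul])).2 h
  refine (congrArg (HasSum _) ?_).mp hs
  symm
  refine he.ext _ _ fun i => ?_
  simp only [sub_apply, one_apply_eq_self, inner_sub_right,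
    he.inner_rankOne hN, inner_sum, inner_smul_right, k.tuplePow_truncatedShift_single he,
    ContinuousLinearMap.adjoint_adjoint, he.inner_adjoint_backwardShift_self k.coeff_pos,
    bMulti_single]
  by_cases hi : i < N
  · have hsub : Finset.range (i + 1) ⊆ Finset.range N := by
      rw [Finset.range_subset_range]; omega
    rw [← Finset.sum_subset hsub]
    · have hb := k.sum_bCoeff_mul_coeff i
      have hai := (k.coeff_pos i).ne'
      rw [Finset.sum_congr rfl (g := fun j =>
        ((k.bCoeff j * k.coeff (i - j) : ℝ) : ℂ) * ((((k.coeff i)⁻¹ : ℝ) : ℂ) * ⟪e i, x⟫_ℂ))]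
      · rw [← Finset.sum_mul, ← Complex.ofReal_sum, hb]
        split_ifs with h0
        · subst h0; simp
        · rw [← mul_assoc, ← Complex.ofReal_mul, mul_inv_cancel₀ hai]; simp
      · intro j hj
        rw [if_pos (by simpa [Nat.lt_succ_iff] using hj)]
        push_cast
        ring
    · intro j _ hj
      rw [if_neg (by simpa [Nat.lt_succ_iff] using hj), mul_zero]
  · rw [he.eq_zero (k := i) (by omega)]
    simp
    omega

theorem isInvContraction_truncatedShift (hN : 0 < N) :
    k.IsInvContraction (k.truncatedShift e N) := by
  refine ⟨fun i j => ?_, _, k.hasDefectSum_truncatedShift he hN, ?_⟩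
  · by_cases hi : i = 0
    · by_cases hj : j = 0
      · rw [hi, hj]
      · rw [truncatedShift, Pi.single_eq_of_ne hj]; exact Commute.zero_right _
    · rw [truncatedShift, Pi.single_eq_of_ne hi]; exact Commute.zero_left _
  · exact (he.isStarProjection_rankOne hN).one_sub.norm_le

/-- A projection is its own nonnegative square root. -/
theorem defect_truncatedShift (hN : 0 < N) :
    k.defect (k.truncatedShift e N) = InnerProductSpace.rankOne ℂ (e 0) (e 0) := by
  rw [defect, (k.hasDefectSum_truncatedShift he hN).defectSum_eq, sub_sub_cancel]
  exact CFC.sqrt_unique (he.isStarProjection_rankOne hN).isIdempotentElem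
    (he.isStarProjection_rankOne hN).nonneg

theorem isPureInvContraction_truncatedShift (hN : 0 < N) :
    k.IsPureInvContraction (k.truncatedShift e N) := by
  refine ⟨k.isInvContraction_truncatedShift he hN, fun x => ?_⟩
  rw [k.defect_truncatedShift he hN]
  set P := InnerProductSpace.rankOne ℂ (e 0) (e 0) with hP
  have h := hasSum_of_single_zero (N := N) (f := fun α => (k.aMulti α : ℂ) •
    (tuplePow (k.truncatedShift e N) α
      (P (P ((tuplePow (k.truncatedShift e N) α).adjoint x)))))
    (fun α hα => by rw [k.tuplePow_truncatedShift_of_ne hα]; simp)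
    (fun j hj => by
      rw [k.tuplePow_truncatedShift_single he, he.backwardShift_eq_zero hj]; simp)
  convert h using 1
  refine he.ext _ _ fun i => ?_
  simp only [inner_sum, inner_smul_right, k.tuplePow_truncatedShift_single he,
    ContinuousLinearMap.adjoint_adjoint, he.inner_adjoint_backwardShift, aMulti_single, hP,
    he.inner_rankOne hN, he.inner_backwardShift, if_true, zero_add]
  by_cases hi : i < N
  -- The projection onto `e 0` leaves only `j = i`, which contributes `a_i * √(1 / a_i) ^ 2 = 1`.
  · rw [Finset.sum_eq_single i]
    · have hai := k.coeff_pos i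
      rw [if_pos ⟨le_rfl, hi⟩, Nat.sub_self, if_pos rfl, k.coeff_zero, ← mul_assoc, ← mul_assoc,
        mul_assoc (k.coeff i : ℂ), ← Complex.ofReal_mul, ← Complex.ofReal_mul,
        Real.mul_self_sqrt (by positivity), mul_one_div_cancel hai.ne']
      simp
    · intro j _ hj
      split_ifs
      · omega
      · simp
      · simp
    · intro h
      exact absurd (Finset.mem_range.2 hi) h
  · rw [he.eq_zero (k := i) (by omega), inner_zero_left, Finset.sum_eq_zero]
    intro j hj
    rw [Finset.mem_range] at hj
    split_ifs
    · omega
    · simp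
    · simp

end Model


/-- The `ULift` puts the model space in the universe over which the hypothesis quantifies. -/
theorem exists_isTruncatedBasis (N : ℕ) :
    ∃ e : ℕ → EuclideanSpace ℂ (ULift.{u} (Fin N)), IsTruncatedBasis e N := by
  classical
  refine ⟨fun k => if h : k < N then EuclideanSpace.single ⟨⟨k, h⟩⟩ 1 else 0, ?_, ?_⟩
  · intro i j
    by_cases hi : i < N
    · by_cases hj : j < N
      · simp [hi, hj, EuclideanSpace.inner_single_left]
      · rw [if_neg (by omega)]
        simp [hj]
    · simp [hi]
  · intro x y h
    ext ⟨⟨i, hi⟩⟩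
    simpa [hi, EuclideanSpace.inner_single_left] using h i

/-! ### The isometry `V_T` of the truncated shift. -/

section Model

variable {H : Type*} [NormedAddCommGroup H] [InnerProductSpace ℂ H] [CompleteSpace H]

variable {d : ℕ} {k : UnitarilyInvariantKernel d} in
theorem IsPureInvContraction.taylorCoeff_poisson {T : Fin d → H →L[ℂ] H}
    (hT : k.IsPureInvContraction T) (x : H) (α : Fin d → ℕ) :
    k.taylorCoeff (hT.poisson x) α = k.poissonCoeff T x α :=
  k.taylorCoeff_ofTaylor _ (hT.hasSum_norm_sq x).summable α

variable {d : ℕ} (k : UnitarilyInvariantKernel (d + 1)) {e : ℕ → H} {N : ℕ}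
  (he : IsTruncatedBasis e N)
include he

theorem mem_defectSpace_truncatedShift (hN : 0 < N) :
    e 0 ∈ k.defectSpace (k.truncatedShift e N) := by
  refine Submodule.le_topologicalClosure _ ⟨e 0, ?_⟩
  change k.defect (k.truncatedShift e N) (e 0) = e 0
  rw [k.defect_truncatedShift he hN, InnerProductSpace.rankOne_apply, he.inner_eq,
    if_pos ⟨rfl, hN⟩, one_smul]

theorem coe_poissonCoeff_truncatedShift (hN : 0 < N) (x : H) (j : ℕ) :
    (k.poissonCoeff (k.truncatedShift e N) x (Pi.single 0 j) : H) =
      (((√(k.coeff j) : ℝ) : ℂ) * ⟪e j, x⟫_ℂ) • e 0 := by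
  change (k.aMulti (Pi.single 0 j) : ℂ) • k.defect (k.truncatedShift e N)
    ((tuplePow (k.truncatedShift e N) (Pi.single 0 j)).adjoint x) = _
  rw [k.defect_truncatedShift he hN, k.tuplePow_truncatedShift_single he,
    ContinuousLinearMap.adjoint_adjoint, InnerProductSpace.rankOne_apply, smul_smul,
    he.inner_backwardShift, zero_add, aMulti_single, k.coeff_zero, ← mul_assoc,
    ← Complex.ofReal_mul, one_div, Real.sqrt_inv, ← div_eq_mul_inv, Real.div_sqrt]

/-- The factor `a_j` in `V_T` meets the weight `√(1 / a_j)` of the shift and leaves `√a_j`, the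
normalization of `z₁ ^ j`. -/
theorem poisson_basis (hN : 0 < N) (hT : k.IsPureInvContraction (k.truncatedShift e N)) {j : ℕ}
    (hj : j < N) :
    hT.poisson (e j) = k.monomial (Pi.single 0 j) ⟨e 0, k.mem_defectSpace_truncatedShift he hN⟩ := by
  refine k.ext_taylorCoeff fun α => Subtype.ext ?_
  rw [hT.taylorCoeff_poisson, taylorCoeff, seq_monomial]
  by_cases hα : α = Pi.single 0 (α 0)
  · rw [hα, k.coe_poissonCoeff_truncatedShift he hN, he.inner_eq, aMulti_single]
    by_cases h : α 0 = j
    · rw [h, Pi.single_eq_same, if_pos ⟨rfl, hj⟩, mul_one]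
      rfl
    · rw [if_neg (fun h' => h h'.1), Pi.single_eq_of_ne, smul_zero]
      · simp
      · exact fun h' => h (Pi.single_injective (M := fun _ : Fin (d + 1) => ℕ) 0 h')
  · have h1 : α ≠ Pi.single 0 j := by
      rintro rfl
      exact hα (by simp)
    rw [Pi.single_eq_of_ne h1, poissonCoeff, k.tuplePow_truncatedShift_of_ne hα]
    simp

theorem adjoint_poisson_monomial_of_lt (hN : 0 < N)
    (hT : k.IsPureInvContraction (k.truncatedShift e N)) {j : ℕ} (hj : j < N) :
    hT.poisson.toContinuousLinearMap.adjoint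
      (k.monomial (Pi.single 0 j) ⟨e 0, k.mem_defectSpace_truncatedShift he hN⟩) = e j := by
  refine ext_inner_right ℂ fun x => ?_
  rw [ContinuousLinearMap.adjoint_inner_left, ← k.poisson_basis he hN hT hj]
  exact hT.poisson.inner_map_map _ _

/-- Since `e j = 0` from `N` on, no function in the range of `V_T` has a `z₁ ^ j` coefficient. -/
theorem adjoint_poisson_monomial_of_le (hN : 0 < N)
    (hT : k.IsPureInvContraction (k.truncatedShift e N)) {j : ℕ} (hj : N ≤ j) :
    hT.poisson.toContinuousLinearMap.adjoint
      (k.monomial (Pi.single 0 j) ⟨e 0, k.mem_defectSpace_truncatedShift he hN⟩) = 0 := by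
  refine ext_inner_right ℂ fun x => ?_
  rw [ContinuousLinearMap.adjoint_inner_left, inner_zero_left]
  have hsq : ((√(k.aMulti (Pi.single 0 j)) : ℝ) : ℂ) ≠ 0 :=
    Complex.ofReal_ne_zero.2 (Real.sqrt_pos.2 (k.aMulti_pos _)).ne'
  refine (mul_eq_zero.1 ?_).resolve_left hsq
  rw [← inner_taylorCoeff]
  change ⟪_, k.taylorCoeff (hT.poisson x) _⟫_ℂ = 0
  have h0 : k.poissonCoeff (k.truncatedShift e N) x (Pi.single 0 j) = 0 := by
    refine Subtype.ext ?_
    rw [k.coe_poissonCoeff_truncatedShift he hN, he.eq_zero hj]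
    simp
  rw [hT.taylorCoeff_poisson, h0, inner_zero_right]

/-- If `k` admits a characteristic function through `l` for the truncated shift of size `N`, then
the first coefficient of `l` is at most `a_{N + 1} / a_N`. -/
theorem AdmitsCharFunction.coeff_one_mul_le {l : UnitarilyInvariantKernel (d + 1)} (hN : 0 < N)
    {hT : k.IsPureInvContraction (k.truncatedShift e N)}
    (h : AdmitsCharFunction.{v} k l hT) : l.coeff 1 * k.coeff N ≤ k.coeff (N + 1) := by
  obtain ⟨E, _, _, _, θ, M, -, hM, hMM⟩ := h
  set w : k.defectSpace (k.truncatedShift e N) :=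
    ⟨e 0, k.mem_defectSpace_truncatedShift he hN⟩ with hw
  have hwn : ‖w‖ = 1 := he.norm_zero hN
  have hMu : ∀ u, M (M.adjoint u) = u - hT.poisson.toContinuousLinearMap
      (hT.poisson.toContinuousLinearMap.adjoint u) := fun u =>
    (DFunLike.congr_fun hMM u).symm
  -- Here and in `hhigh`, `‖M* u‖² = ⟪M M* u, u⟫` with `M M* = I - V_T V_T*`, which is `0` on the
  -- range of `V_T` and `I` on its complement.
  have hlow : ∀ j < N, M.adjoint (k.monomial (Pi.single 0 j) w) = 0 := by
    intro j hj
    rw [← inner_self_eq_zero (𝕜 := ℂ), ContinuousLinearMap.adjoint_inner_left, hMu, hw,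
      k.adjoint_poisson_monomial_of_lt he hN hT hj]
    change ⟪_, _ - hT.poisson (e j)⟫_ℂ = 0
    rw [k.poisson_basis he hN hT hj, sub_self, inner_zero_right]
  have hhigh : ∀ j, N ≤ j → ‖M.adjoint (k.monomial (Pi.single 0 j) w)‖ = 1 := by
    intro j hj
    have h1 : ⟪M.adjoint (k.monomial (Pi.single 0 j) w),
        M.adjoint (k.monomial (Pi.single 0 j) w)⟫_ℂ =
        ⟪k.monomial (Pi.single 0 j) w, k.monomial (Pi.single 0 j) w⟫_ℂ := by
      rw [ContinuousLinearMap.adjoint_inner_left, hMu, hw,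
        k.adjoint_poisson_monomial_of_le he hN hT hj, map_zero, sub_zero]
    have h2 := congrArg RCLike.re h1
    rw [inner_self_eq_norm_sq, inner_self_eq_norm_sq, norm_monomial, hwn, one_pow] at h2
    exact (pow_eq_one_iff_of_nonneg (norm_nonneg _) two_ne_zero).1 h2
  exact k.coeff_one_mul_le_of_multiplier l hM 0 N w hlow (hhigh N le_rfl)
    (hhigh (N + 1) (Nat.le_succ N)).le

end Model

/-! ### Binomial coefficients of the Bergman kernels and the conclusion. -/

theorem bergman_coeff (d : ℕ) (m : ℕ+) (j : ℕ) :
    (bergman d m).coeff j = ((j + ((m : ℕ) - 1)).choose ((m : ℕ) - 1) : ℝ) :=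
  rfl

theorem bergman_coeff_one (d : ℕ) (n : ℕ+) : (bergman d n).coeff 1 = n := by
  have hn := n.pos
  rw [bergman_coeff, show 1 + ((n : ℕ) - 1) = ((n : ℕ) - 1) + 1 by omega, Nat.choose_succ_self_right]
  exact_mod_cast Nat.sub_add_cancel hn

/-- By symmetry the two coefficients are `C(2m, m + 1)` and `C(2m - 1, m)`, and `(m + 1) C(2m, m +
1) = 2m C(2m - 1, m)`. -/
theorem bergman_coeff_succ_lt (d : ℕ) (m : ℕ+) :
    (bergman d m).coeff (m + 1) < 2 * (bergman d m).coeff m := by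
  have h1 := Nat.add_one_mul_choose_eq ((m : ℕ) + (m - 1)) m
  have hm := m.pos
  have hpos := (bergman d m).coeff_pos m
  rw [bergman_coeff] at hpos
  rw [bergman_coeff, bergman_coeff]
  rw [show (m : ℕ) + 1 + (m - 1) = (m + (m - 1)) + 1 by omega,
    ← Nat.choose_symm_of_eq_add (show (m : ℕ) + (m - 1) + 1 = (m + 1) + (m - 1) by omega)]
  rw [Nat.choose_symm_of_eq_add (show (m : ℕ) + (m - 1) = (m - 1) + m by omega)] at hpos ⊢
  norm_cast at hpos ⊢
  have h2 : ((m : ℕ) + (m - 1) + 1) = 2 * m := by omega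
  rw [h2] at h1 ⊢
  nlinarith

end UnitarilyInvariantKernel

end

theorem mainTheorem4 (d : ℕ) (hd : 1 ≤ d) (m n : ℕ+)
    (h : UnitarilyInvariantKernel.AdmitsCharFunctionThrough.{u, v}
      (UnitarilyInvariantKernel.bergman d m) (UnitarilyInvariantKernel.bergman d n)) :
    n = 1 := by
  obtain ⟨d, rfl⟩ := Nat.exists_eq_add_of_le' hd
  -- Truncation size `N = m`, large enough for `a_(N+1) / a_N < 2`.
  obtain ⟨e, he⟩ := UnitarilyInvariantKernel.exists_isTruncatedBasis.{u} m
  have h1 := UnitarilyInvariantKernel.AdmitsCharFunction.coeff_one_mul_le _ he m.pos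
    (h _ _ (UnitarilyInvariantKernel.isPureInvContraction_truncatedShift _ he m.pos))
  have h2 := h1.trans_lt (UnitarilyInvariantKernel.bergman_coeff_succ_lt _ m)
  have h3 := lt_of_mul_lt_mul_right h2 ((UnitarilyInvariantKernel.bergman (d + 1) m).coeff_pos m).le
  rw [UnitarilyInvariantKernel.bergman_coeff_one] at h3
  have h4 : (n : ℕ) < 2 := by exact_mod_cast h3
  have h5 := n.pos
  exact PNat.eq (by rw [PNat.one_coe]; omega)
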